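/- Fix $0<a<1$ and $\varepsilon>0$. For a function $F$ and $x>0$ write $$\frac1{2\pi i}\int_{(a)}x^{-s}F(s)\,ds=\lim_{n\to\infty}\frac1{2\pi i}\int_{a-in}^{a+in}x^{-s}F(s)\,ds$$ (limit over positive integers $n$) whenever the limit exists; it exists and has the same value whenever the integral over the line $\operatorname{Re}s=a$ converges absolutely or as a Cauchy principal value. For an integer $n\ge1$ let $R(n)$ be the semicircle in $\operatorname{Re}s\le a$ whose diameter is the segment $[a-in,a+in]$, run from $a+in$ to $a-in$. We say that the line of integration can be closed to the left for $F$ at $x$ if $\int_{R(n)}x^{-s}F(s)\,ds\to0$ as $n\to\infty$. Let $G$ be meromorphic on $\operatorname{Re}s<a+\varepsilon$, holomorphic there except for at most simple poles at $s=0,-1,-2,\dots$, with residues $c_0,c_1,c_2,\dots$ (some $c_n$ may be $0$). **(2)** If $x>0$, the integral $g(x)=\frac1{2\pi i}\int_{(a)}x^{-s}G(s)\,ds$ exists and the line can be closed to the left for $G$ at $x$, then the series $\sum_{n\ge0}c_nx^n$ converges and $$g(x)=\sum_{n=0}^\infty c_nx^n .$$ If this hypothesis holds for all $x\in(0,R)$,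 where $0<R\le\infty$, then the series converges absolutely on $(0,R)$; that is, $g$ is a power series there. **(3)** Let $f$ be holomorphic on $\operatorname{Re}s<a+\varepsilon$, and let $x>0$ be such that the line can be closed to the left for $fG$ at $x$. If the series $\sum_{n\ge0} c_nf(-n)x^n$ converges, then the integral on the left below exists and $$\frac1{2\pi i}\int_{(a)}x^{-s}f(s)G(s)\,ds=\sum_{n=0}^\infty c_nf(-n)x^n .$$ In particular, if the integral over the line exists as a Cauchy principal value, or absolutely, that value equals the sum. **(4)** In particular, for $G=\Gamma$: if $f$ is holomorphic on $\operatorname{Re}s<a+\varepsilon$, the line can be closed to the left for $f\Gamma$ at $x>0$, and $\sum_{n\ge0}\frac{(-1)^n}{n!}f(-n)x^n$ converges, then, with the same meaning of the integral, $$\frac1{2\pi i}\int_{(a)}x^{-s}f(s)\Gamma(s)\,ds=\sum_{n=0}^\infty\frac{(-1)^n}{n!}f(-n)x^n .$$ -/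

import Mathlib

open Filter Topology MeasureTheory

/-- `G` has at `p` a principal part `c / (s - p)`: its Laurent expansion there is
`c / (s - p) + (holomorphic)`.  This is a simple pole with residue `c` when `c ≠ 0`, and a
removable singularity when `c = 0`. The value `G p` is irrelevant. -/
def HasSimplePoleWithResidue (G : ℂ → ℂ) (p c : ℂ) : Prop :=
  ∃ h : ℂ → ℂ, AnalyticAt ℂ h p ∧ ∀ᶠ s in 𝓝[≠] p, G s = c / (s - p) + h s

/-- `G` is meromorphic on the half plane `Re s < b`, its only singularities there are at most
simple poles at `0, -1, -2, …`, and the residue at `-n` is `c n`. -/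
structure HasPolesAtNonposIntegers (G : ℂ → ℂ) (b : ℝ) (c : ℕ → ℂ) : Prop where
  meromorphicOn : MeromorphicOn G {s : ℂ | s.re < b}
  differentiableOn : DifferentiableOn ℂ G {s : ℂ | s.re < b ∧ ∀ n : ℕ, s ≠ -(n : ℂ)}
  residue : ∀ n : ℕ, HasSimplePoleWithResidue G (-(n : ℂ)) (c n)

/-- The integrand `x ^ (-s) * G s` of the inverse Mellin integral. -/
noncomputable def mellinKernel (G : ℂ → ℂ) (x : ℝ) (s : ℂ) : ℂ := (x : ℂ) ^ (-s) * G s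

/-- `∫ F(s) ds` over the upward segment `[a - iT, a + iT]`. -/
noncomputable def segmentIntegral (a : ℝ) (F : ℂ → ℂ) (T : ℝ) : ℂ :=
  ∫ t in (-T)..T, F ((a : ℂ) + (t : ℂ) * Complex.I) * Complex.I

/-- `∫ F(s) ds` over the semicircle `R(n)` to the left of the line `Re s = a` having the segment
`[a - in, a + in]` as diameter, run counterclockwise from `a + in` to `a - in`. -/
noncomputable def leftSemicircleIntegral (a : ℝ) (F : ℂ → ℂ) (n : ℕ) : ℂ :=
  ∫ θ in (Real.pi / 2)..(3 * Real.pi / 2),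
    F (circleMap (a : ℂ) (n : ℝ) θ) * deriv (circleMap (a : ℂ) (n : ℝ)) θ

/-- The line of integration in `∫_{(a)} x ^ (-s) G(s) ds` can be closed to the left:
the integrals over the semicircles `R(n)` tend to zero. -/
def CanBeClosedToLeft (a : ℝ) (G : ℂ → ℂ) (x : ℝ) : Prop :=
  Tendsto (fun n : ℕ => leftSemicircleIntegral a (mellinKernel G x) n) atTop (𝓝 0)

/-- `y = (1 / 2πi) ∫_{(a)} x ^ (-s) G(s) ds`, the integral over the vertical line being the
Cauchy principal value `lim_{T → ∞} ∫_{a - iT}^{a + iT}`, `T` real. -/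
def IsInverseMellin (a : ℝ) (G : ℂ → ℂ) (x : ℝ) (y : ℂ) : Prop :=
  Tendsto (fun T : ℝ =>
    1 / (2 * (Real.pi : ℂ) * Complex.I) * segmentIntegral a (mellinKernel G x) T) atTop (𝓝 y)

/-- The same, with the limit taken only along the segments `[a - in, a + in]`, `n ∈ ℕ`, which
belong to the contours `L(n) = [a - in, a + in] ∪ R(n)`. -/
def IsInverseMellinAlongNat (a : ℝ) (G : ℂ → ℂ) (x : ℝ) (y : ℂ) : Prop :=
  Tendsto (fun n : ℕ =>
    1 / (2 * (Real.pi : ℂ) * Complex.I) * segmentIntegral a (mellinKernel G x) n) atTop (𝓝 y)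

theorem IsInverseMellin.alongNat {a : ℝ} {G : ℂ → ℂ} {x : ℝ} {y : ℂ}
    (h : IsInverseMellin a G x y) : IsInverseMellinAlongNat a G x y :=
  Tendsto.comp (g := fun T : ℝ =>
    1 / (2 * (Real.pi : ℂ) * Complex.I) * segmentIntegral a (mellinKernel G x) T)
    h tendsto_natCast_atTop_atTop

/-- If the integral converges absolutely, the principal value is Mathlib's `mellinInv`. -/
theorem isInverseMellin_mellinInv {a : ℝ} {G : ℂ → ℂ} {x : ℝ}
    (h : Complex.VerticalIntegrable (mellinKernel G x) a) :
    IsInverseMellin a G x (mellinInv a G x) := by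
  have h1 := intervalIntegral_tendsto_integral (μ := volume) h
    tendsto_neg_atTop_atBot tendsto_id
  have h2 := h1.const_mul (1 / (2 * (Real.pi : ℂ)))
  have e : mellinInv a G x = 1 / (2 * (Real.pi : ℂ)) *
      ∫ y : ℝ, mellinKernel G x ((a : ℂ) + (y : ℂ) * Complex.I) := by
    simp [mellinInv, mellinKernel, Complex.real_smul]
  unfold IsInverseMellin
  rw [e]
  refine h2.congr fun T => ?_
  have hpi : (Real.pi : ℂ) ≠ 0 := by exact_mod_cast Real.pi_ne_zero
  rw [segmentIntegral, intervalIntegral.integral_mul_const]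
  field_simp [Complex.I_ne_zero]
  simp [mul_comm]

/-! Everything reduces to a residue theorem for the half disc bounded by the segment and `R(n)`:
since 0 < a < 1, it encloses exactly the poles 0, ..., -(n-1), so the truncated integral minus the
n-th partial sum is a multiple of the integral over `R(n)`, which tends to 0. Hence either limit
yields the other: (2) goes from the integral to the series, (3) and (4) from the series to the
integral. Absolute convergence on (0, R) is Abel's lemma.

The residue theorem is proved by primitives. On a disc containing the closed half disc, F minus
finitely many principal parts has a primitive, whose increments along segment and arc cancel.
Principal parts are integrated by logarithms, with the opposite branch on the arc for enclosed
poles; the branch mismatch at the endpoints gives 2πi per pole. -/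

theorem isClosed_range_neg_natCast : IsClosed (Set.range fun n : ℕ => -(n : ℂ)) := by
  have h := Complex.isClosedEmbedding_intCast.isClosedMap (Set.range fun n : ℕ => -(n : ℤ))
    (isClosed_discrete _)
  rw [← Set.range_comp] at h
  simpa [Function.comp_def] using h

theorem isOpen_halfPlane_diff_nonposIntegers (b : ℝ) :
    IsOpen {s : ℂ | s.re < b ∧ ∀ n : ℕ, s ≠ -(n : ℂ)} := by
  have h : {s : ℂ | s.re < b ∧ ∀ n : ℕ, s ≠ -(n : ℂ)} =
      {s : ℂ | s.re < b} ∩ (Set.range fun n : ℕ => -(n : ℂ))ᶜ := by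
    ext s
    simp [eq_comm]
  rw [h]
  exact (isOpen_lt Complex.continuous_re continuous_const).inter
    isClosed_range_neg_natCast.isOpen_compl

theorem isOpen_re_lt (b : ℝ) : IsOpen {s : ℂ | s.re < b} :=
  isOpen_lt Complex.continuous_re continuous_const

/-! ### Calculus of principal parts. -/

theorem HasSimplePoleWithResidue.of_analyticAt {h : ℂ → ℂ} {p : ℂ} (hh : AnalyticAt ℂ h p) :
    HasSimplePoleWithResidue h p 0 :=
  ⟨h, hh, by simp⟩

theorem HasSimplePoleWithResidue.congr {F G : ℂ → ℂ} {p c : ℂ}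
    (hF : HasSimplePoleWithResidue F p c) (h : F =ᶠ[𝓝[≠] p] G) :
    HasSimplePoleWithResidue G p c := by
  obtain ⟨φ, hφ, hF⟩ := hF
  refine ⟨φ, hφ, ?_⟩
  filter_upwards [hF, h] with s h1 h2
  rw [← h2, h1]

theorem HasSimplePoleWithResidue.sub {F G : ℂ → ℂ} {p c d : ℂ}
    (hF : HasSimplePoleWithResidue F p c) (hG : HasSimplePoleWithResidue G p d) :
    HasSimplePoleWithResidue (fun s => F s - G s) p (c - d) := by
  obtain ⟨φ, hφ, hF⟩ := hF
  obtain ⟨ψ, hψ, hG⟩ := hG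
  refine ⟨fun s => φ s - ψ s, hφ.sub hψ, ?_⟩
  filter_upwards [hF, hG] with s h1 h2
  rw [h1, h2]
  ring

theorem HasSimplePoleWithResidue.finset_sum {ι : Type*} (t : Finset ι) {F : ι → ℂ → ℂ} {p : ℂ}
    {c : ι → ℂ} (hF : ∀ i ∈ t, HasSimplePoleWithResidue (F i) p (c i)) :
    HasSimplePoleWithResidue (fun s => ∑ i ∈ t, F i s) p (∑ i ∈ t, c i) := by
  classical
  choose! φ hφ hF using hF
  refine ⟨fun s => ∑ i ∈ t, φ i s, Finset.analyticAt_fun_sum t hφ, ?_⟩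
  have h : ∀ᶠ s in 𝓝[≠] p, ∀ i ∈ t, F i s = c i / (s - p) + φ i s :=
    (Filter.eventually_all_finset t).2 hF
  filter_upwards [h] with s hs
  rw [Finset.sum_congr rfl hs, Finset.sum_add_distrib, Finset.sum_div]

/-- K(s)/(s - p) = K(p)/(s - p) + `dslope K p s`, and the divided difference of an analytic function
is analytic. -/
theorem HasSimplePoleWithResidue.analyticAt_mul {F K : ℂ → ℂ} {p c : ℂ}
    (hF : HasSimplePoleWithResidue F p c) (hK : AnalyticAt ℂ K p) :
    HasSimplePoleWithResidue (fun s => K s * F s) p (c * K p) := by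
  obtain ⟨φ, hφ, hF⟩ := hF
  obtain ⟨q, hq⟩ := hK
  have hd : AnalyticAt ℂ (dslope K p) p := ⟨_, hq.has_fpower_series_dslope_fslope⟩
  refine ⟨fun s => c * dslope K p s + K s * φ s,
    (analyticAt_const.mul hd).add (AnalyticAt.mul ⟨q, hq⟩ hφ), ?_⟩
  filter_upwards [hF, self_mem_nhdsWithin] with s h1 h2
  have h3 : s - p ≠ 0 := sub_ne_zero.2 h2
  rw [h1, dslope_of_ne _ h2, slope_def_field]
  field_simp
  ring

theorem hasSimplePoleWithResidue_div_sub (p c : ℂ) :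
    HasSimplePoleWithResidue (fun s => c / (s - p)) p c :=
  ⟨fun _ => 0, analyticAt_const, by simp⟩

/-- Removal of singularities: a function agreeing near every point of a set, except possibly at the
point, with an analytic function has an analytic modification on the set. -/
theorem exists_analyticAt_of_eventuallyEq_punctured {F : ℂ → ℂ} {U : Set ℂ}
    (hF : ∀ z ∈ U, HasSimplePoleWithResidue F z 0) :
    ∃ E : ℂ → ℂ, (∀ z ∈ U, AnalyticAt ℂ E z) ∧ ∀ z ∈ U, ContinuousAt F z → E z = F z := by
  refine ⟨fun z => limUnder (𝓝[≠] z) F, fun z hz => ?_, fun z _ hc =>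
    (hc.tendsto.mono_left nhdsWithin_le_nhds).limUnder_eq⟩
  obtain ⟨φ, hφ, h⟩ := hF z hz
  simp only [zero_div, zero_add] at h
  refine hφ.congr ?_
  have key : ∀ w, ContinuousAt φ w → (∀ᶠ s in 𝓝[≠] w, F s = φ s) →
      φ w = limUnder (𝓝[≠] w) F := fun w hw h =>
    (Tendsto.limUnder_eq ((hw.tendsto.mono_left nhdsWithin_le_nhds).congr'
      (h.mono fun _ h => h.symm))).symm
  -- Agreement is only known off z, but a point w ≠ z close to z has a whole neighbourhood avoiding
  -- z, so the punctured limit at w is also φ(w).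
  have h2 : ∀ᶠ w in 𝓝 z, w ≠ z → ∀ᶠ s in 𝓝[≠] w, F s = φ s := by
    have h3 := eventually_nhdsWithin_iff.1 h
    filter_upwards [eventually_eventually_nhds.2 h3] with w hw hne
    refine Filter.Eventually.filter_mono nhdsWithin_le_nhds ?_
    filter_upwards [hw, isOpen_ne.mem_nhds hne] with s hs hs'
    exact hs hs'
  filter_upwards [h2, hφ.eventually_analyticAt] with w hw hw'
  by_cases hwz : w = z
  · subst hwz
    exact key w hw'.continuousAt h
  · exact key w hw'.continuousAt (hw hwz)

/-! ### Functions with simple poles at the nonpositive integers. -/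

theorem HasPolesAtNonposIntegers.analyticAt {G : ℂ → ℂ} {b : ℝ} {c : ℕ → ℂ}
    (hG : HasPolesAtNonposIntegers G b c) {s : ℂ} (hs : s.re < b) (hs' : ∀ n : ℕ, s ≠ -(n : ℂ)) :
    AnalyticAt ℂ G s :=
  hG.differentiableOn.analyticAt
    ((isOpen_halfPlane_diff_nonposIntegers b).mem_nhds ⟨hs, hs'⟩)

theorem HasPolesAtNonposIntegers.mul {G K : ℂ → ℂ} {b : ℝ} {c : ℕ → ℂ} (hb : 0 < b)
    (hG : HasPolesAtNonposIntegers G b c) (hK : DifferentiableOn ℂ K {s : ℂ | s.re < b}) :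
    HasPolesAtNonposIntegers (fun s => K s * G s) b (fun n => c n * K (-(n : ℂ))) where
  meromorphicOn := fun s hs =>
    (hK.analyticAt ((isOpen_re_lt b).mem_nhds hs)).meromorphicAt.fun_mul (hG.meromorphicOn s hs)
  differentiableOn := (hK.mono fun _ h => h.1).mul hG.differentiableOn
  residue := fun n => (hG.residue n).analyticAt_mul
    (hK.analyticAt ((isOpen_re_lt b).mem_nhds (by
      simp only [Set.mem_ofPred_eq, Complex.neg_re, Complex.natCast_re]
      have : (0 : ℝ) ≤ n := n.cast_nonneg
      linarith)))

theorem HasPolesAtNonposIntegers.mellinKernel {G : ℂ → ℂ} {b : ℝ} {c : ℕ → ℂ} (hb : 0 < b)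
    (hG : HasPolesAtNonposIntegers G b c) {x : ℝ} (hx : 0 < x) :
    HasPolesAtNonposIntegers (mellinKernel G x) b (fun n => c n * (x : ℂ) ^ n) := by
  have hx' : (x : ℂ) ≠ 0 := by exact_mod_cast hx.ne'
  have hK : Differentiable ℂ fun s : ℂ => (x : ℂ) ^ (-s) := fun s =>
    differentiableAt_id.neg.const_cpow (Or.inl hx')
  have h := hG.mul hb hK.differentiableOn
  simp only [neg_neg, Complex.cpow_natCast] at h
  exact h

/-- On a disc, a function with simple poles at non-positive integers is the derivative of a
holomorphic function plus finitely many principal parts. -/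
theorem HasPolesAtNonposIntegers.exists_primitive {F : ℂ → ℂ} {b : ℝ} {d : ℕ → ℂ}
    (hF : HasPolesAtNonposIntegers F b d) {z₀ : ℂ} {r : ℝ}
    (hr : Metric.ball z₀ r ⊆ {s : ℂ | s.re < b}) (n : ℕ) :
    ∃ M ≥ n, ∃ P : ℂ → ℂ, ∀ s ∈ Metric.ball z₀ r, (∀ k : ℕ, s ≠ -(k : ℂ)) →
      HasDerivAt P (F s - ∑ k ∈ Finset.range M, d k / (s - -(k : ℂ))) s := by
  obtain ⟨N, hN⟩ := exists_nat_gt (r + ‖z₀‖)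
  -- N makes the subtracted principal parts cover every pole in the disc; M ≥ n ensures that the n
  -- enclosed poles are among them.
  set M := max n N with hM
  have hout : ∀ k : ℕ, -(k : ℂ) ∈ Metric.ball z₀ r → k < M := by
    intro k hk
    have h1 : ‖-(k : ℂ)‖ < r + ‖z₀‖ := by
      have := norm_add_le (-(k : ℂ) - z₀) z₀
      rw [sub_add_cancel] at this
      have h2 := mem_ball_iff_norm.1 hk
      linarith
    rw [norm_neg, Complex.norm_natCast] at h1
    have h3 : (k : ℝ) < N := h1.trans hN
    exact lt_of_lt_of_le (by exact_mod_cast h3) (le_max_right _ _)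
  have hpp : ∀ s : ℂ, ∀ k : ℕ, s ≠ -(k : ℂ) →
      AnalyticAt ℂ (fun s : ℂ => d k / (s - -(k : ℂ))) s := fun s k hk =>
    analyticAt_const.div (analyticAt_id.sub analyticAt_const) (sub_ne_zero.2 hk)
  have hreg : ∀ s ∈ Metric.ball z₀ r, (∀ k : ℕ, s ≠ -(k : ℂ)) →
      AnalyticAt ℂ (fun s => F s - ∑ k ∈ Finset.range M, d k / (s - -(k : ℂ))) s :=
    fun s hs hk => (hF.analyticAt (hr hs) hk).sub
      (Finset.analyticAt_fun_sum _ fun k _ => hpp s k (hk k))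
  obtain ⟨E, hE, hEF⟩ := exists_analyticAt_of_eventuallyEq_punctured
    (F := fun s => F s - ∑ k ∈ Finset.range M, d k / (s - -(k : ℂ))) (U := Metric.ball z₀ r) (by
      intro z hz
      by_cases hzk : ∃ k : ℕ, z = -(k : ℂ)
      · obtain ⟨k, rfl⟩ := hzk
        have h1 := (hF.residue k).sub (HasSimplePoleWithResidue.finset_sum (Finset.range M)
          (F := fun j s => d j / (s - -(j : ℂ))) (p := -(k : ℂ))
          (c := fun j => if j = k then d k else 0) (by
            intro j _
            by_cases hjk : j = k
            · subst hjk
              simpa using hasSimplePoleWithResidue_div_sub (-(j : ℂ)) (d j)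
            · simp only [hjk, if_false]
              refine .of_analyticAt (hpp _ j ?_)
              simpa [eq_comm] using hjk))
        rwa [Finset.sum_ite_eq', if_pos (Finset.mem_range.2 (hout k hz)), sub_self] at h1
      · push Not at hzk
        exact .of_analyticAt (hreg z hz hzk))
  obtain ⟨P, hP⟩ := DifferentiableOn.isExactOn_ball (f := E) (c := z₀) (r := r)
    fun s hs => (hE s hs).differentiableAt.differentiableWithinAt
  refine ⟨M, le_max_left _ _, P, fun s hs hk => ?_⟩
  rw [← hEF s hs (hreg s hs hk).continuousAt]
  exact hP s hs

/-! ### The residue theorem on half discs. -/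

theorem closed_halfDisk_subset_ball {a ε : ℝ} (hε : 0 < ε) (n : ℝ) :
    ∃ (z₀ : ℂ) (r : ℝ), Metric.ball z₀ r ⊆ {s : ℂ | s.re < a + ε} ∧
      ∀ s : ℂ, ‖s - a‖ ≤ n → s.re ≤ a → s ∈ Metric.ball z₀ r := by
  -- The disc with centre a - C and radius C + ε touches Re s = a + ε from the left. On the half
  -- disc the squared distance to the centre is at most n² + C² = 2Cε + C² < (C + ε)².
  set C : ℝ := n ^ 2 / (2 * ε) with hC
  have hC0 : 0 ≤ C := by positivity
  have hCε : 2 * C * ε = n ^ 2 := by rw [hC]; field_simp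
  refine ⟨((a - C : ℝ) : ℂ), C + ε, fun s hs => ?_, fun s hs hsa => ?_⟩
  · have h1 := mem_ball_iff_norm.1 hs
    have h2 := (Complex.re_le_norm _).trans_lt h1
    simp only [Complex.sub_re, Complex.ofReal_re] at h2
    simp only [Set.mem_ofPred_eq]
    linarith
  · rw [mem_ball_iff_norm]
    refine lt_of_pow_lt_pow_left₀ 2 (by positivity) ?_
    have h1 : ‖s - a‖ ^ 2 ≤ n ^ 2 := pow_le_pow_left₀ (norm_nonneg _) hs 2
    rw [Complex.sq_norm, Complex.normSq_apply] at h1 ⊢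
    simp only [Complex.sub_re, Complex.sub_im, Complex.ofReal_re, Complex.ofReal_im] at h1 ⊢
    nlinarith [mul_nonneg hC0 (sub_nonneg.2 hsa)]

/-- The fundamental theorem of calculus along a curve, for a function that is the derivative of
`P` plus principal parts with logarithmic primitives `L k`. -/
theorem integral_eq_sub_of_hasDerivAt_add_sum {F P : ℂ → ℂ} {L : ℕ → ℂ → ℂ} {d : ℕ → ℂ} {M : ℕ}
    {γ γ' : ℝ → ℂ} {u v : ℝ} (hγ : ∀ t, HasDerivAt γ (γ' t) t) (hγ' : Continuous γ')
    (hF : ∀ t ∈ Set.uIcc u v, ContinuousAt F (γ t))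
    (hP : ∀ t ∈ Set.uIcc u v,
      HasDerivAt P (F (γ t) - ∑ k ∈ Finset.range M, d k / (γ t - -(k : ℂ))) (γ t))
    (hL : ∀ t ∈ Set.uIcc u v, ∀ k, HasDerivAt (L k) (1 / (γ t - -(k : ℂ))) (γ t)) :
    ∫ t in u..v, F (γ t) * γ' t =
      (P (γ v) - P (γ u)) + ∑ k ∈ Finset.range M, d k * (L k (γ v) - L k (γ u)) := by
  have hint : IntervalIntegrable (fun t => F (γ t) * γ' t) volume u v := by
    refine ContinuousOn.intervalIntegrable fun t ht => ContinuousAt.continuousWithinAt ?_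
    exact (ContinuousAt.comp (hF t ht) (hγ t).continuousAt).mul hγ'.continuousAt
  have hder : ∀ t ∈ Set.uIcc u v, HasDerivAt
      (fun t => P (γ t) + ∑ k ∈ Finset.range M, d k * L k (γ t)) (F (γ t) * γ' t) t := by
    intro t ht
    have h1 : HasDerivAt (fun s => P s + ∑ k ∈ Finset.range M, d k * L k s)
        (F (γ t)) (γ t) := by
      have h2 := (hP t ht).fun_add (HasDerivAt.fun_sum (u := Finset.range M)
        fun k _ => (hL t ht k).const_mul (d k))
      simpa [div_eq_mul_inv] using h2
    exact h1.comp t (hγ t)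
  rw [intervalIntegral.integral_eq_sub_of_hasDerivAt hder hint]
  simp only [mul_sub, Finset.sum_sub_distrib]
  ring

/-- Negation shifts the principal logarithm by -πi in the upper half plane and by +πi in the lower
one. This is the contribution of one enclosed pole: log along the segment, log of the negative along
the arc. -/
theorem log_sub_log_conj_add_log_neg {z : ℂ} (hz : 0 < z.im) {w : ℂ} (hw : w.im < 0)
    (h : ‖w‖ = ‖z‖) :
    (Complex.log z - Complex.log w) + (Complex.log (-w) - Complex.log (-z)) =
      2 * Real.pi * Complex.I := by
  simp only [Complex.log, norm_neg, h, Complex.arg_neg_eq_arg_sub_pi_of_im_pos hz,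
    Complex.arg_neg_eq_arg_add_pi_of_im_neg hw]
  push_cast
  ring

theorem circleMap_re (a : ℝ) (n θ : ℝ) : (circleMap (a : ℂ) n θ).re = a + n * Real.cos θ := by
  simp [circleMap, Complex.exp_ofReal_mul_I_re]

theorem circleMap_im (a : ℝ) (n θ : ℝ) : (circleMap (a : ℂ) n θ).im = n * Real.sin θ := by
  simp [circleMap, Complex.exp_ofReal_mul_I_im]

/-- The residue theorem for the half discs bounded by `[a - in, a + in]` and `R(n)`. -/
theorem HasPolesAtNonposIntegers.segmentIntegral_add_leftSemicircleIntegral {F : ℂ → ℂ}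
    {a ε : ℝ} {d : ℕ → ℂ} (ha0 : 0 < a) (ha1 : a < 1) (hε : 0 < ε)
    (hF : HasPolesAtNonposIntegers F (a + ε) d) (n : ℕ) :
    segmentIntegral a F n + leftSemicircleIntegral a F n =
      2 * Real.pi * Complex.I * ∑ k ∈ Finset.range n, d k := by
  rcases Nat.eq_zero_or_pos n with rfl | hn
  · simp only [segmentIntegral, leftSemicircleIntegral, deriv_circleMap]
    simp
  have hn0 : (0 : ℝ) < n := by exact_mod_cast hn
  obtain ⟨z₀, r, hr, hball⟩ := closed_halfDisk_subset_ball (a := a) hε (n : ℝ)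
  obtain ⟨M, hM, P, hP⟩ := hF.exists_primitive hr n
  have hpi := Real.pi_pos
  -- the segment
  set σ : ℝ → ℂ := fun t => (a : ℂ) + (t : ℂ) * Complex.I with hσ
  have hσre : ∀ t, (σ t).re = a := fun t => by simp [hσ]
  have hσim : ∀ t, (σ t).im = t := fun t => by simp [hσ]
  have hσball : ∀ t ∈ Set.uIcc (-(n : ℝ)) n, σ t ∈ Metric.ball z₀ r := fun t ht => by
    rw [Set.uIcc_of_le (by linarith)] at ht
    refine hball _ ?_ (hσre t).le
    simpa [hσ] using abs_le.2 ht
  have hσk : ∀ t, ∀ k : ℕ, σ t ≠ -(k : ℂ) := fun t k h => by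
    have h1 := congrArg Complex.re h
    rw [hσre, Complex.neg_re, Complex.natCast_re] at h1
    have : (0 : ℝ) ≤ k := k.cast_nonneg
    linarith
  have hseg := integral_eq_sub_of_hasDerivAt_add_sum (F := F) (P := P) (d := d) (M := M)
    (L := fun k s => Complex.log (s - -(k : ℂ)))
    (γ := σ) (γ' := fun _ => Complex.I) (u := -(n : ℝ)) (v := n)
    (fun t => by
      have h := ((hasDerivAt_id t).ofReal_comp.mul_const Complex.I).const_add (a : ℂ)
      rwa [Complex.ofReal_one, one_mul] at h)
    continuous_const
    (fun t ht => (hF.analyticAt (hr (hσball t ht)) (hσk t)).continuousAt)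
    (fun t ht => hP _ (hσball t ht) (hσk t))
    (fun t _ k => by
      refine ((hasDerivAt_id _).sub_const _).clog (Or.inl ?_)
      simp only [Complex.sub_re, hσre, Complex.neg_re, Complex.natCast_re]
      have : (0 : ℝ) ≤ k := k.cast_nonneg
      linarith)
  -- the semicircle
  set ρ : ℝ → ℂ := circleMap (a : ℂ) (n : ℝ) with hρ
  have hcos : ∀ θ ∈ Set.uIcc (Real.pi / 2) (3 * Real.pi / 2), Real.cos θ ≤ 0 := fun θ hθ => by
    rw [Set.uIcc_of_le (by linarith)] at hθ
    exact Real.cos_nonpos_of_pi_div_two_le_of_le hθ.1 (by linarith [hθ.2])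
  -- The arc meets the real axis only at a - n.
  have hρreal : ∀ θ ∈ Set.uIcc (Real.pi / 2) (3 * Real.pi / 2), (ρ θ).im = 0 →
      (ρ θ).re = a - n := fun θ hθ h => by
    rw [hρ, circleMap_im] at h
    have hs : Real.sin θ = 0 := (mul_eq_zero.1 h).resolve_left hn0.ne'
    have hc : Real.cos θ = -1 := by
      have h1 := Real.sin_sq_add_cos_sq θ
      rw [hs] at h1
      nlinarith [hcos θ hθ, sq_nonneg (Real.cos θ + 1)]
    rw [hρ, circleMap_re, hc]
    ring
  have hρball : ∀ θ ∈ Set.uIcc (Real.pi / 2) (3 * Real.pi / 2), ρ θ ∈ Metric.ball z₀ r :=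
    fun θ hθ => by
      refine hball _ (by simp [hρ]) ?_
      rw [hρ, circleMap_re]
      nlinarith [hcos θ hθ]
  have hlt : ∀ k : ℕ, k < n → (k : ℝ) ≤ n - 1 := fun k hk => by
    have : ((k + 1 : ℕ) : ℝ) ≤ n := by exact_mod_cast hk
    push_cast at this
    linarith
  have hle : ∀ k : ℕ, ¬ k < n → (n : ℝ) ≤ k := fun k hk => by exact_mod_cast not_lt.1 hk
  -- The crossing point satisfies -n < a - n < -(n - 1): it lies left of -k for k < n and right of
  -- -k for k ≥ n. Choosing the sign accordingly keeps the arc off the branch cut.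
  have hslit : ∀ θ ∈ Set.uIcc (Real.pi / 2) (3 * Real.pi / 2), ∀ k : ℕ,
      if k < n then -(ρ θ - -(k : ℂ)) ∈ Complex.slitPlane
        else ρ θ - -(k : ℂ) ∈ Complex.slitPlane := fun θ hθ k => by
    split_ifs with hk
    all_goals
      rw [Complex.mem_slitPlane_iff]
      by_cases him : (ρ θ).im = 0
      · left
        have h1 := hρreal θ hθ him
        simp only [Complex.neg_re, Complex.sub_re, Complex.natCast_re, h1]
        first
          | linarith [hlt k hk]
          | linarith [hle k hk]
      · right
        simpa using him
  have hρk : ∀ θ ∈ Set.uIcc (Real.pi / 2) (3 * Real.pi / 2), ∀ k : ℕ, ρ θ ≠ -(k : ℂ) :=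
    fun θ hθ k h => by
      have h1 := hslit θ hθ k
      simp [h] at h1
  have hsemi := integral_eq_sub_of_hasDerivAt_add_sum (F := F) (P := P) (d := d) (M := M)
    (L := fun k s => if k < n then Complex.log (-(s - -(k : ℂ))) else Complex.log (s - -(k : ℂ)))
    (γ := ρ) (γ' := deriv ρ) (u := Real.pi / 2) (v := 3 * Real.pi / 2)
    (fun θ => (differentiable_circleMap _ _ θ).hasDerivAt)
    (by
      rw [hρ, show deriv (circleMap (a : ℂ) (n : ℝ)) = fun θ => circleMap 0 n θ * Complex.I from
        funext fun θ => deriv_circleMap _ _ θ]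
      fun_prop)
    (fun t ht => (hF.analyticAt (hr (hρball t ht)) (hρk t ht)).continuousAt)
    (fun t ht => hP _ (hρball t ht) (hρk t ht))
    (fun t ht k => by
      have h1 := hslit t ht k
      split_ifs at h1 ⊢ with hk
      · have h2 := ((hasDerivAt_id (ρ t)).sub_const (-(k : ℂ))).fun_neg.clog h1
        simp only [id] at h2
        rwa [neg_div_neg_eq] at h2
      · exact ((hasDerivAt_id (ρ t)).sub_const (-(k : ℂ))).clog h1)
  have htop : ρ (Real.pi / 2) = σ n := by
    apply Complex.ext <;> simp [hρ, circleMap_re, circleMap_im, hσ]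
  have hbot : ρ (3 * Real.pi / 2) = σ (-(n : ℝ)) := by
    have h1 : 3 * Real.pi / 2 = Real.pi / 2 + Real.pi := by ring
    apply Complex.ext <;> simp [hρ, circleMap_re, circleMap_im, hσ, h1,
      Real.cos_add_pi, Real.sin_add_pi]
  rw [htop, hbot] at hsemi
  rw [segmentIntegral, leftSemicircleIntegral]
  rw [hseg, hsemi]
  -- For k ≥ n both curves use the same logarithm and the increments cancel; for k < n the branches
  -- differ.
  have hterm : ∀ k ∈ Finset.range M,
      d k * (Complex.log (σ n - -(k : ℂ)) - Complex.log (σ (-(n : ℝ)) - -(k : ℂ))) +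
      d k * ((if k < n then Complex.log (-(σ (-(n : ℝ)) - -(k : ℂ)))
          else Complex.log (σ (-(n : ℝ)) - -(k : ℂ))) -
        (if k < n then Complex.log (-(σ n - -(k : ℂ))) else Complex.log (σ n - -(k : ℂ)))) =
      if k < n then 2 * Real.pi * Complex.I * d k else 0 := fun k _ => by
    split_ifs with hk
    · have hzw : ‖σ (-(n : ℝ)) - -(k : ℂ)‖ = ‖σ n - -(k : ℂ)‖ := by
        rw [← Complex.norm_conj (σ n - -(k : ℂ))]
        congr 1
        apply Complex.ext <;> simp [hσ]
      have := log_sub_log_conj_add_log_neg (z := σ n - -(k : ℂ)) (w := σ (-(n : ℝ)) - -(k : ℂ))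
        (by simpa [hσim] using hn) (by simpa [hσim] using hn) hzw
      rw [← mul_add, this]
      ring
    · ring
  have hsum := Finset.sum_congr rfl hterm
  rw [Finset.sum_add_distrib, ← Finset.sum_filter] at hsum
  have hfilter : (Finset.range M).filter (fun k => k < n) = Finset.range n := by
    ext k
    simp only [Finset.mem_filter, Finset.mem_range]
    omega
  rw [hfilter, ← Finset.mul_sum] at hsum
  rw [← hsum]
  ring

/-- When the line can be closed to the left, the truncated inverse Mellin integrals and the partial
sums of the residue series differ by a null sequence. -/
theorem HasPolesAtNonposIntegers.tendsto_sub_sum_residues {G : ℂ → ℂ} {a ε : ℝ} {c : ℕ → ℂ}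
    (ha0 : 0 < a) (ha1 : a < 1) (hε : 0 < ε) (hG : HasPolesAtNonposIntegers G (a + ε) c)
    {x : ℝ} (hx : 0 < x) (hcl : CanBeClosedToLeft a G x) :
    Tendsto (fun n : ℕ => 1 / (2 * (Real.pi : ℂ) * Complex.I) *
      segmentIntegral a (_root_.mellinKernel G x) n - ∑ k ∈ Finset.range n, c k * (x : ℂ) ^ k)
      atTop (𝓝 0) := by
  have h := (Tendsto.const_mul (1 / (2 * (Real.pi : ℂ) * Complex.I)) hcl).neg
  rw [mul_zero, neg_zero] at h
  refine h.congr fun n => ?_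
  have h1 := (hG.mellinKernel (by linarith) hx).segmentIntegral_add_leftSemicircleIntegral
    ha0 ha1 hε n
  have h2 := Complex.two_pi_I_ne_zero
  rw [← eq_sub_iff_add_eq] at h1
  rw [h1]
  field_simp
  ring

theorem HasPolesAtNonposIntegers.tendsto_sum_residues {G : ℂ → ℂ} {a ε : ℝ} {c : ℕ → ℂ}
    (ha0 : 0 < a) (ha1 : a < 1) (hε : 0 < ε) (hG : HasPolesAtNonposIntegers G (a + ε) c)
    {x : ℝ} (hx : 0 < x) (hcl : CanBeClosedToLeft a G x) {y : ℂ}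
    (hy : IsInverseMellinAlongNat a G x y) :
    Tendsto (fun N : ℕ => ∑ n ∈ Finset.range N, c n * (x : ℂ) ^ n) atTop (𝓝 y) := by
  simpa using Tendsto.sub hy (hG.tendsto_sub_sum_residues ha0 ha1 hε hx hcl)

theorem HasPolesAtNonposIntegers.isInverseMellinAlongNat {G : ℂ → ℂ} {a ε : ℝ} {c : ℕ → ℂ}
    (ha0 : 0 < a) (ha1 : a < 1) (hε : 0 < ε) (hG : HasPolesAtNonposIntegers G (a + ε) c)
    {x : ℝ} (hx : 0 < x) (hcl : CanBeClosedToLeft a G x) {S : ℂ}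
    (hS : Tendsto (fun N : ℕ => ∑ n ∈ Finset.range N, c n * (x : ℂ) ^ n) atTop (𝓝 S)) :
    IsInverseMellinAlongNat a G x S := by
  simpa [IsInverseMellinAlongNat] using
    (hG.tendsto_sub_sum_residues ha0 ha1 hε hx hcl).add hS

/-- Abel's lemma: a power series with bounded terms at `y` converges absolutely at every
`x` with `‖x‖ < ‖y‖`. -/
theorem summable_mul_pow_of_bounded {c : ℕ → ℂ} {x y C : ℝ} (hx : 0 < x) (hxy : x < y)
    (hC : ∀ n, ‖c n * (y : ℂ) ^ n‖ ≤ C) : Summable fun n => c n * (x : ℂ) ^ n := by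
  have hy : 0 < y := hx.trans hxy
  refine Summable.of_norm_bounded (g := fun n => C * (x / y) ^ n)
    ((summable_geometric_of_lt_one (by positivity) ((div_lt_one hy).2 hxy)).mul_left C)
    fun n => ?_
  have h : c n * (x : ℂ) ^ n = c n * (y : ℂ) ^ n * ((x / y : ℝ) : ℂ) ^ n := by
    have : (y : ℂ) ≠ 0 := by exact_mod_cast hy.ne'
    push_cast
    rw [mul_assoc, ← mul_pow, mul_div_cancel₀ _ this]
  rw [h, norm_mul, norm_pow, Complex.norm_real, Real.norm_of_nonneg (by positivity)]
  exact mul_le_mul_of_nonneg_right (hC n) (by positivity)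

/-- Conditional convergence at y suffices: the terms there tend to 0, hence are bounded. -/
theorem summable_mul_pow_of_tendsto_sum {c : ℕ → ℂ} {x y : ℝ} {S : ℂ} (hx : 0 < x) (hxy : x < y)
    (hS : Tendsto (fun N : ℕ => ∑ n ∈ Finset.range N, c n * (y : ℂ) ^ n) atTop (𝓝 S)) :
    Summable fun n => c n * (x : ℂ) ^ n := by
  have h0 : Tendsto (fun n : ℕ => c n * (y : ℂ) ^ n) atTop (𝓝 0) := by
    have h := ((tendsto_add_atTop_iff_nat 1).2 hS).sub hS
    simpa [Finset.sum_range_succ] using h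
  obtain ⟨C, hC⟩ := (Metric.isBounded_range_of_tendsto _ h0).exists_norm_le
  exact summable_mul_pow_of_bounded hx hxy fun n => hC _ ⟨n, rfl⟩

/-! ### The poles of Γ. -/

/-- Γ(s) = Γ(s + 1)/s gives residue Γ(1) = 1 at 0, and passing from -n to -(n + 1) divides the
residue by -(n + 1). -/
theorem hasSimplePoleWithResidue_Gamma (n : ℕ) :
    HasSimplePoleWithResidue Complex.Gamma (-(n : ℂ)) ((-1 : ℂ) ^ n / (n.factorial : ℂ)) := by
  induction n with
  | zero =>
    have h1 : AnalyticAt ℂ (fun s => Complex.Gamma (s + 1)) (-((0 : ℕ) : ℂ)) := by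
      refine (AnalyticAt.fun_comp (g := Complex.Gamma) ?_ (by fun_prop))
      have h2 : DifferentiableOn ℂ Complex.Gamma {s : ℂ | 0 < s.re} := fun s hs =>
        (Complex.differentiableAt_Gamma s fun m hm => by
          have h3 : 0 < s.re := hs
          rw [hm] at h3
          simp only [Complex.neg_re, Complex.natCast_re] at h3
          have : (0 : ℝ) ≤ m := m.cast_nonneg
          linarith).differentiableWithinAt
      exact h2.analyticAt ((isOpen_lt continuous_const Complex.continuous_re).mem_nhds (by simp))
    have h2 := (hasSimplePoleWithResidue_div_sub (-((0 : ℕ) : ℂ)) 1).analyticAt_mul h1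
    simp only [Nat.cast_zero, neg_zero, zero_add, Complex.Gamma_one, mul_one, sub_zero] at h2
    simp only [Nat.cast_zero, neg_zero, pow_zero, Nat.factorial_zero, Nat.cast_one, div_one]
    refine h2.congr ?_
    filter_upwards [self_mem_nhdsWithin] with s hs
    rw [Complex.Gamma_add_one s hs]
    field_simp [show s ≠ 0 from hs]
  | succ n ih =>
    obtain ⟨φ, hφ, h⟩ := ih
    have hp : (-((n + 1 : ℕ) : ℂ)) + 1 = -(n : ℂ) := by push_cast; ring
    have hp0 : (-((n + 1 : ℕ) : ℂ)) ≠ 0 := neg_ne_zero.2 (Nat.cast_ne_zero.2 n.succ_ne_zero)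
    have hshift : HasSimplePoleWithResidue (fun s => Complex.Gamma (s + 1))
        (-((n + 1 : ℕ) : ℂ)) ((-1 : ℂ) ^ n / (n.factorial : ℂ)) := by
      refine ⟨fun s => φ (s + 1), AnalyticAt.fun_comp (g := φ) (by rwa [hp]) (by fun_prop), ?_⟩
      have ht : Tendsto (fun s : ℂ => s + 1) (𝓝[≠] (-((n + 1 : ℕ) : ℂ))) (𝓝[≠] (-(n : ℂ))) := by
        rw [← hp]
        exact (continuous_id.add continuous_const).continuousAt.continuousWithinAt.tendsto_nhdsWithin
          fun s hs h => hs (add_right_cancel h)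
      filter_upwards [ht.eventually h] with s hs
      rw [hs, ← hp]
      congr 2
      ring
    have h2 := hshift.analyticAt_mul (K := fun s => s⁻¹) (analyticAt_inv hp0)
    have hc : (-1 : ℂ) ^ n / (n.factorial : ℂ) * (-((n + 1 : ℕ) : ℂ))⁻¹ =
        (-1 : ℂ) ^ (n + 1) / ((n + 1).factorial : ℂ) := by
      have h3 : (n.factorial : ℂ) ≠ 0 := Nat.cast_ne_zero.2 n.factorial_ne_zero
      have h4 : ((n : ℂ) + 1) ≠ 0 := by exact_mod_cast n.succ_ne_zero
      rw [Nat.factorial_succ]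
      push_cast
      field_simp
      ring
    rw [hc] at h2
    refine h2.congr ?_
    filter_upwards [nhdsWithin_le_nhds (isOpen_ne.mem_nhds hp0)] with s hs
    rw [Complex.Gamma_add_one s hs]
    field_simp [show s ≠ 0 from hs]

theorem hasPolesAtNonposIntegers_Gamma (b : ℝ) :
    HasPolesAtNonposIntegers Complex.Gamma b (fun n => (-1 : ℂ) ^ n / (n.factorial : ℂ)) where
  meromorphicOn := fun s _ => by
    -- Γ is the inverse of the entire function 1/Γ.
    have h := (Complex.differentiable_one_div_Gamma.analyticAt s).meromorphicAt.inv
    have e : (fun s : ℂ => (Complex.Gamma s)⁻¹)⁻¹ = Complex.Gamma := by ext; simp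
    rwa [e] at h
  differentiableOn := fun s hs => (Complex.differentiableAt_Gamma s hs.2).differentiableWithinAt
  residue := hasSimplePoleWithResidue_Gamma

/-! ### The inversion formulas. -/

theorem HasPolesAtNonposIntegers.inverseMellin_mul {G : ℂ → ℂ} {a ε : ℝ} {c : ℕ → ℂ}
    (ha0 : 0 < a) (ha1 : a < 1) (hε : 0 < ε) (hG : HasPolesAtNonposIntegers G (a + ε) c)
    {f : ℂ → ℂ} (hf : DifferentiableOn ℂ f {s : ℂ | s.re < a + ε}) {x : ℝ} (hx : 0 < x)
    (hcl : CanBeClosedToLeft a (fun s => f s * G s) x) {S : ℂ}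
    (hS : Tendsto (fun N : ℕ => ∑ n ∈ Finset.range N, c n * f (-(n : ℂ)) * (x : ℂ) ^ n)
      atTop (𝓝 S)) :
    IsInverseMellinAlongNat a (fun s => f s * G s) x S ∧
      (∀ y : ℂ, IsInverseMellin a (fun s => f s * G s) x y → y = S) ∧
      (Complex.VerticalIntegrable (_root_.mellinKernel (fun s => f s * G s) x) a →
        mellinInv a (fun s => f s * G s) x = S) := by
  have h := (hG.mul (by linarith) hf).isInverseMellinAlongNat ha0 ha1 hε hx hcl hS
  exact ⟨h, fun y hy => tendsto_nhds_unique hy.alongNat h,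
    fun hi => tendsto_nhds_unique (isInverseMellin_mellinInv hi).alongNat h⟩

theorem mainTheorem4 (a ε : ℝ) (ha0 : 0 < a) (ha1 : a < 1) (hε : 0 < ε)
    (G : ℂ → ℂ) (c : ℕ → ℂ) (hG : HasPolesAtNonposIntegers G (a + ε) c) :
    -- formula (2), at every point `x` where the line can be closed
    (∀ (g : ℝ → ℂ) (x : ℝ), 0 < x → IsInverseMellinAlongNat a G x (g x) →
      CanBeClosedToLeft a G x →
      Tendsto (fun N : ℕ => ∑ n ∈ Finset.range N, c n * (x : ℂ) ^ n) atTop (𝓝 (g x))) ∧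
    -- formula (2) on an interval `(0, R)`: `g` is an (absolutely convergent) power series
    (∀ (g : ℝ → ℂ) (R : ENNReal),
      (∀ x : ℝ, 0 < x → ENNReal.ofReal x < R →
        IsInverseMellinAlongNat a G x (g x) ∧ CanBeClosedToLeft a G x) →
      ∀ x : ℝ, 0 < x → ENNReal.ofReal x < R → HasSum (fun n : ℕ => c n * (x : ℂ) ^ n) (g x)) ∧
    -- formula (3)
    (∀ f : ℂ → ℂ, DifferentiableOn ℂ f {s : ℂ | s.re < a + ε} →
      ∀ x : ℝ, 0 < x → CanBeClosedToLeft a (fun s => f s * G s) x →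
      ∀ S : ℂ, Tendsto (fun N : ℕ => ∑ n ∈ Finset.range N, c n * f (-(n : ℂ)) * (x : ℂ) ^ n)
          atTop (𝓝 S) →
        IsInverseMellinAlongNat a (fun s => f s * G s) x S ∧
        (∀ y : ℂ, IsInverseMellin a (fun s => f s * G s) x y → y = S) ∧
        (Complex.VerticalIntegrable (mellinKernel (fun s => f s * G s) x) a →
          mellinInv a (fun s => f s * G s) x = S)) ∧
    -- formula (4)
    (∀ f : ℂ → ℂ, DifferentiableOn ℂ f {s : ℂ | s.re < a + ε} →
      ∀ x : ℝ, 0 < x → CanBeClosedToLeft a (fun s => f s * Complex.Gamma s) x →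
      ∀ S : ℂ, Tendsto (fun N : ℕ => ∑ n ∈ Finset.range N,
          (-1 : ℂ) ^ n / (n.factorial : ℂ) * f (-(n : ℂ)) * (x : ℂ) ^ n) atTop (𝓝 S) →
        IsInverseMellinAlongNat a (fun s => f s * Complex.Gamma s) x S ∧
        (∀ y : ℂ, IsInverseMellin a (fun s => f s * Complex.Gamma s) x y → y = S) ∧
        (Complex.VerticalIntegrable (mellinKernel (fun s => f s * Complex.Gamma s) x) a →
          mellinInv a (fun s => f s * Complex.Gamma s) x = S)) := by
  refine ⟨fun g x hx hg hcl => hG.tendsto_sum_residues ha0 ha1 hε hx hcl hg,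
    fun g R h x hx hxR => ?_,
    fun f hf x hx hcl S hS => hG.inverseMellin_mul ha0 ha1 hε hf hx hcl hS,
    fun f hf x hx hcl S hS =>
      (hasPolesAtNonposIntegers_Gamma (a + ε)).inverseMellin_mul ha0 ha1 hε hf hx hcl hS⟩
  have hsum : ∀ y : ℝ, 0 < y → ENNReal.ofReal y < R →
      Tendsto (fun N : ℕ => ∑ n ∈ Finset.range N, c n * (y : ℂ) ^ n) atTop (𝓝 (g y)) :=
    fun y hy hyR => hG.tendsto_sum_residues ha0 ha1 hε hy (h y hy hyR).2 (h y hy hyR).1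
  -- At x itself only the ordered partial sums are known to converge; a point y strictly between x
  -- and R upgrades this to summability at x.
  obtain ⟨y, hxy, hyR⟩ := ENNReal.lt_iff_exists_nnreal_btwn.1 hxR
  have hxy' : x < y := by
    rwa [ENNReal.ofReal, ENNReal.coe_lt_coe, Real.toNNReal_lt_iff_lt_coe hx.le] at hxy
  have hs := summable_mul_pow_of_tendsto_sum hx hxy'
    (hsum y (hx.trans hxy') (by rwa [ENNReal.ofReal_coe_nnreal]))
  rw [← tendsto_nhds_unique hs.hasSum.tendsto_sum_nat (hsum x hx hxR)]
  exact hs.hasSum
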